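/- Let $p$ be a prime, $q = 1/p$, and let $n \ge 1$ and $\mu \ge 1$ be integers. For an integer $m \geq 1$, the $m$-rank of a matrix $A$ over $\mathbf{Z}_m$ (the integers modulo $m$) is the greatest integer $r$ such that $A$ has an $r\times r$ submatrix (not necessarily contiguous) whose determinant is nonzero modulo $m$, or $0$ if there is no such submatrix. Let $P(n,m)$ be the probability that a random symmetric $n\times n$ matrix over $\mathbf{Z}_m$ (entries $a_{ij}=a_{ji}$, $i \le j$, chosen independently and uniformly from $\mathbf{Z}_m$) has $m$-rank $n$, and put $Q(n,m) = 1 - P(n,m)$. Let $\Pi_i(x) = \prod_{j=1}^{i}(1-x^j)$, $k=\lfloor n/2\rfloor$ and $s=\lfloor(\mu-1)/2\rfloor$. Then $$Q(n,p^\mu) = 1 - P(n,p^\mu) = \frac{q^\mu(1-q^n)-R}{1-q},$$ where $$R = q^{s+1}\sum_{j=0}^{k-1}\left(q^\mu(1-q^n)-q^{2s+2}(1-q^{2j+1})\right) q^{2j}\, \frac{\Pi_{2j}(q)\,\Pi_{j+s}(q^2)}{\Pi_j(q^2)^2\,\Pi_s(q^2)}.$$ Moreover, $0 \le R < q^{3\mu/2}$.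 -/

import Mathlib

/-- The `m`-rank of a square matrix with entries modulo `m`: the greatest `k` such that the matrix
has a (not necessarily contiguous) `k` by `k` submatrix whose determinant is nonzero modulo `m`,
or `0` if there is no such submatrix. (The set below is bounded by `n`, and `sSup ∅ = 0`.) -/
noncomputable def mRank {m n : ℕ} (A : Matrix (Fin n) (Fin n) (ZMod m)) : ℕ :=
  sSup {k : ℕ | ∃ r c : Fin k ↪o Fin n, (A.submatrix r c).det ≠ 0}

/-- `P(n,m)`: the probability that a random `n` by `n` symmetric matrix over `ℤ/m` has `m`-rank `n`.
Choosing the entries on and above the diagonal independently and uniformly is the same as choosing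
the matrix uniformly from the finite set of all symmetric matrices. (Used for `m ≥ 1` only.) -/
noncomputable def probP (n m : ℕ) : ℝ :=
  ({A : Matrix (Fin n) (Fin n) (ZMod m) | A.IsSymm ∧ mRank A = n}.ncard : ℝ) /
    ({A : Matrix (Fin n) (Fin n) (ZMod m) | A.IsSymm}.ncard : ℝ)

/-- `Q(n,m) = 1 - P(n,m)`. -/
noncomputable def probQ (n m : ℕ) : ℝ := 1 - probP n m

/-- `Π_n(x) = ∏_{j=1}^n (1 - x^j)`. -/
noncomputable def qPi (n : ℕ) (x : ℝ) : ℝ := ∏ j ∈ Finset.Icc 1 n, (1 - x ^ j)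

/-- The explicit finite sum `R`, as a function of `q`, `n`, `μ`, `k`, `s`. -/
noncomputable def remainderR (q : ℝ) (n μ k s : ℕ) : ℝ :=
  q ^ (s + 1) * ∑ j ∈ Finset.range k,
    (q ^ μ * (1 - q ^ n) - q ^ (2 * s + 2) * (1 - q ^ (2 * j + 1))) * q ^ (2 * j) *
      ((qPi (2 * j) q * qPi (j + s) (q ^ 2)) / (qPi j (q ^ 2) ^ 2 * qPi s (q ^ 2)))

open Finset BigOperators

/-! ### Sequences satisfying the determinant recursion -/

theorem eq_zero_of_eq_mul_shift {X : ℕ → ℝ} {c : ℝ} {M d : ℕ} (hc : c ≠ 1) (hd : 1 ≤ d)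
    (h : ∀ ν ≤ M, X ν = c * X (ν - d)) : ∀ ν ≤ M, X ν = 0 := by
  intro ν
  induction ν using Nat.strong_induction_on with
  | _ ν ih =>
    intro hν
    have h1 := h ν hν
    rcases Nat.eq_zero_or_pos ν with rfl | hpos
    · rw [Nat.zero_sub] at h1
      have : (1 - c) * X 0 = 0 := by linear_combination h1
      rcases mul_eq_zero.1 this with h2 | h2
      · exact absurd (by linarith) hc
      · exact h2
    · rw [h1, ih (ν - d) (by omega) (by omega), mul_zero]

/-- The recursion satisfied by the probabilities `D n ν` that `p ^ ν` divides the determinant of a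
random symmetric matrix of size `n`, in the range `ν ≤ M`. -/
structure DetRecursion (D : ℕ → ℕ → ℝ) (q : ℝ) (M : ℕ) : Prop where
  zero_right : ∀ n, D n 0 = 1
  zero_left : ∀ ν, 1 ≤ ν → ν ≤ M → D 0 ν = 0
  step : ∀ n, ∀ ν ≤ M, D (n + 1) ν = (1 - q) * D n ν + q * (1 - q ^ n) * D (n - 1) ν +
    q ^ (n + 1) * ((1 - q) * D n (ν - 1) + q * D (n + 1) (ν - 2))

namespace DetRecursion

variable {D : ℕ → ℕ → ℝ} {q : ℝ} {M : ℕ}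

theorem even_of_odd (h : DetRecursion D q M) (k : ℕ)
    (hV : ∀ ν ≤ M, (1 - q ^ (2 * k + 1)) * D (2 * k) ν =
      D (2 * k + 1) ν - q ^ (2 * k + 1) * D (2 * k + 1) (ν - 1)) :
    ∀ ν ≤ M, D (2 * k + 2) ν - q ^ (2 * k + 3) * D (2 * k + 2) (ν - 2) =
      D (2 * k + 1) ν - q ^ (2 * k + 3) * D (2 * k + 1) (ν - 1) := by
  intro ν hν
  have h1 := h.step (2 * k + 1) ν hν
  simp only [Nat.add_sub_cancel] at h1
  linear_combination h1 + q * hV ν hν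

theorem odd_of_odd (h : DetRecursion D q M) (hq0 : 0 < q) (hq1 : q < 1) (k : ℕ)
    (hV : ∀ ν ≤ M, (1 - q ^ (2 * k + 1)) * D (2 * k) ν =
      D (2 * k + 1) ν - q ^ (2 * k + 1) * D (2 * k + 1) (ν - 1)) :
    ∀ ν ≤ M, D (2 * k + 3) ν - q ^ (2 * k + 3) * D (2 * k + 3) (ν - 2) =
      (1 - q ^ (2 * k + 3)) * D (2 * k + 1) ν := by
  have hR := h.even_of_odd k hV
  have key := eq_zero_of_eq_mul_shift (M := M) (d := 2) (c := q ^ (2 * k + 4))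
    (X := fun ν => D (2 * k + 3) ν - q ^ (2 * k + 3) * D (2 * k + 3) (ν - 2) -
      (1 - q ^ (2 * k + 3)) * D (2 * k + 1) ν)
    (pow_lt_one₀ hq0.le hq1 (by omega)).ne (by norm_num) (by
      intro ν hν
      have h1 := h.step (2 * k + 2) ν hν
      have h2 := h.step (2 * k + 2) (ν - 2) (by omega)
      have h3 := hR ν hν
      have h4 := hR (ν - 1) (by omega)
      have e1 : ν - 2 - 1 = ν - 3 := by omega
      have e2 : ν - 2 - 2 = ν - 4 := by omega
      have e3 : ν - 1 - 2 = ν - 3 := by omega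
      have e4 : ν - 1 - 1 = ν - 2 := by omega
      have e5 : 2 * k + 2 - 1 = 2 * k + 1 := by omega
      simp only [e1, e2, e3, e4, e5] at h1 h2 h3 h4 ⊢
      linear_combination h1 - q ^ (2 * k + 3) * h2 + (1 - q) * h3 +
        (1 - q) * q ^ (2 * k + 3) * h4)
  intro ν hν
  linear_combination key ν hν

theorem even_eq (h : DetRecursion D q M) (hq0 : 0 < q) (hq1 : q < 1) (k : ℕ) :
    ∀ ν ≤ M, (1 - q ^ (2 * k + 1)) * D (2 * k) ν =
      D (2 * k + 1) ν - q ^ (2 * k + 1) * D (2 * k + 1) (ν - 1) := by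
  induction k with
  | zero =>
    have key := eq_zero_of_eq_mul_shift (M := M) (d := 1) (c := -q)
      (X := fun ν => D 1 ν - q * D 1 (ν - 1) - (1 - q) * D 0 ν) (by linarith) le_rfl (by
        intro ν hν
        have h1 := h.step 0 ν hν
        have e1 : ν - 1 - 1 = ν - 2 := by omega
        simp only [e1]
        simp only [zero_add, pow_zero, pow_one, zero_tsub] at h1
        linear_combination h1)
    intro ν hν
    simp only [mul_zero, zero_add, pow_one]
    linear_combination -key ν hν
  | succ k ih =>
    have hR := h.even_of_odd k ih
    have hR1 := h.odd_of_odd hq0 hq1 k ih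
    have key := eq_zero_of_eq_mul_shift (M := M) (d := 2) (c := q ^ (2 * k + 3))
      (X := fun ν => D (2 * k + 3) ν - q ^ (2 * k + 3) * D (2 * k + 3) (ν - 1) -
        (1 - q ^ (2 * k + 3)) * D (2 * k + 2) ν)
      (pow_lt_one₀ hq0.le hq1 (by omega)).ne (by norm_num) (by
        intro ν hν
        have h3 := hR ν hν
        have h4 := hR1 ν hν
        have h5 := hR1 (ν - 1) (by omega)
        have e1 : ν - 2 - 1 = ν - 3 := by omega
        have e3 : ν - 1 - 2 = ν - 3 := by omega
        simp only [e1, e3] at h3 h4 h5 ⊢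
        linear_combination h4 - q ^ (2 * k + 3) * h5 - (1 - q ^ (2 * k + 3)) * h3)
    intro ν hν
    have e : 2 * (k + 1) = 2 * k + 2 := by ring
    rw [e]
    linear_combination -key ν hν

theorem odd_eq (h : DetRecursion D q M) (hq0 : 0 < q) (hq1 : q < 1) (k : ℕ) :
    ∀ ν ≤ M, D (2 * k + 3) ν - q ^ (2 * k + 3) * D (2 * k + 3) (ν - 2) =
      (1 - q ^ (2 * k + 3)) * D (2 * k + 1) ν :=
  h.odd_of_odd hq0 hq1 k (h.even_eq hq0 hq1 k)

theorem one_eq (h : DetRecursion D q M) (hq0 : 0 < q) (hq1 : q < 1) :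
    ∀ ν ≤ M, D 1 ν = q ^ ν := by
  intro ν
  induction ν with
  | zero => intro _; simp [h.zero_right]
  | succ ν ih =>
    intro hν
    have h1 := h.even_eq hq0 hq1 0 (ν + 1) hν
    simp only [mul_zero, zero_add, pow_one, h.zero_left (ν + 1) (by omega) hν,
      Nat.add_sub_cancel, ih (by omega)] at h1
    linear_combination -h1

end DetRecursion

/-! ### The closed form -/

/-- The ratio `Π_{2j}(q) / Π_j(q²)²`. -/
noncomputable def oddEvenRatio (q : ℝ) (j : ℕ) : ℝ := qPi (2 * j) q / qPi j (q ^ 2) ^ 2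

/-- The summand `q^{2j} Π_{2j}(q) / Π_j(q²)² · (z; q²)_j`. -/
noncomputable def detTerm (q : ℝ) (j : ℕ) (z : ℝ) : ℝ :=
  q ^ (2 * j) * oddEvenRatio q j * ∏ i ∈ range j, (1 - z * q ^ (2 * i))

/-- `1 - q` times the probability of a determinant divisible by `p ^ μ`, as a function of
`x = q ^ μ`, `y = q ^ σ`, `z = q ^ (2 σ)`, where `σ = ⌈μ / 2⌉`. -/
noncomputable def detForm (q : ℝ) (k n : ℕ) (x y z : ℝ) : ℝ :=
  x * (1 - q ^ n) * (1 - y * ∑ j ∈ range k, detTerm q j z) +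
    y * z * ∑ j ∈ range k, (1 - q ^ (2 * j + 1)) * detTerm q j z

theorem qPi_succ (n : ℕ) (x : ℝ) : qPi (n + 1) x = qPi n x * (1 - x ^ (n + 1)) := by
  rw [qPi, qPi, Finset.prod_Icc_succ_top (by omega)]

theorem qPi_zero (x : ℝ) : qPi 0 x = 1 := by simp [qPi]

theorem qPi_pos {x : ℝ} (h0 : 0 ≤ x) (h1 : x < 1) (n : ℕ) : 0 < qPi n x :=
  Finset.prod_pos fun j hj => by
    have := pow_lt_one₀ h0 h1 (n := j) (by have := Finset.mem_Icc.1 hj; omega)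
    linarith

theorem oddEvenRatio_zero (q : ℝ) : oddEvenRatio q 0 = 1 := by simp [oddEvenRatio, qPi_zero]

theorem oddEvenRatio_succ {q : ℝ} (h0 : 0 < q) (h1 : q < 1) (j : ℕ) :
    oddEvenRatio q (j + 1) * (1 - q ^ (2 * j + 2)) = oddEvenRatio q j * (1 - q ^ (2 * j + 1)) := by
  have hq2 : q ^ 2 < 1 := pow_lt_one₀ h0.le h1 (by norm_num)
  have hP := (qPi_pos (sq_nonneg q) hq2 j).ne'
  have h2 : q ^ (2 * j + 2) < 1 := pow_lt_one₀ h0.le h1 (by omega)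
  have h3 : 1 - q ^ (2 * j + 2) ≠ 0 := by linarith
  have e : (q ^ 2) ^ (j + 1) = q ^ (2 * j + 2) := by rw [← pow_mul]; ring_nf
  rw [oddEvenRatio, oddEvenRatio, show 2 * (j + 1) = 2 * j + 1 + 1 by ring, qPi_succ, qPi_succ,
    qPi_succ, e]
  field_simp

theorem prod_one_sub_shift (q z : ℝ) (j : ℕ) :
    (1 - z) * ∏ i ∈ range j, (1 - q ^ 2 * z * q ^ (2 * i)) =
      ∏ i ∈ range (j + 1), (1 - z * q ^ (2 * i)) := by
  rw [Finset.prod_range_succ', mul_comm]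
  simp only [mul_zero, pow_zero, mul_one]
  congr 1
  exact Finset.prod_congr rfl fun i _ => by ring

theorem sum_detTerm_shift {q : ℝ} (h0 : 0 < q) (h1 : q < 1) (z : ℝ) (K : ℕ) :
    ∑ j ∈ range (K + 1), detTerm q j z =
      oddEvenRatio q K * ∏ i ∈ range K, (1 - q ^ 2 * z * q ^ (2 * i)) +
        q * ∑ j ∈ range K, detTerm q j (q ^ 2 * z) := by
  induction K with
  | zero => simp [detTerm]
  | succ K ih =>
    have h2 : q ^ (2 * K + 2) < 1 := pow_lt_one₀ h0.le h1 (by omega)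
    have h3 : 1 - q ^ (2 * K + 2) ≠ 0 := by linarith
    rw [Finset.sum_range_succ, ih, Finset.sum_range_succ (n := K)]
    unfold detTerm
    rw [← prod_one_sub_shift, Finset.prod_range_succ]
    have hw : oddEvenRatio q (K + 1) =
        oddEvenRatio q K * (1 - q ^ (2 * K + 1)) / (1 - q ^ (2 * K + 2)) := by
      rw [eq_div_iff h3, oddEvenRatio_succ h0 h1]
    rw [hw]
    field_simp
    ring

theorem sum_odd_detTerm_shift {q : ℝ} (h0 : 0 < q) (h1 : q < 1) (z : ℝ) (K : ℕ) :
    ∑ j ∈ range (K + 1), (1 - q ^ (2 * j + 1)) * detTerm q j z =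
      (1 - q ^ (2 * K + 1)) * oddEvenRatio q K *
          ∏ i ∈ range K, (1 - q ^ 2 * z * q ^ (2 * i)) +
        q ^ 3 * ∑ j ∈ range K, (1 - q ^ (2 * j + 1)) * detTerm q j (q ^ 2 * z) := by
  induction K with
  | zero => simp [detTerm]
  | succ K ih =>
    have h2 : q ^ (2 * K + 2) < 1 := pow_lt_one₀ h0.le h1 (by omega)
    have h3 : 1 - q ^ (2 * K + 2) ≠ 0 := by linarith
    rw [Finset.sum_range_succ, ih, Finset.sum_range_succ (n := K)]
    unfold detTerm
    rw [← prod_one_sub_shift, Finset.prod_range_succ]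
    have hw : oddEvenRatio q (K + 1) =
        oddEvenRatio q K * (1 - q ^ (2 * K + 1)) / (1 - q ^ (2 * K + 2)) := by
      rw [eq_div_iff h3, oddEvenRatio_succ h0 h1]
    rw [hw]
    field_simp
    ring

theorem detForm_odd {q : ℝ} (h0 : 0 < q) (h1 : q < 1) (k : ℕ) (x y z : ℝ) :
    detForm q (k + 1) (2 * k + 3) (q ^ 2 * x) (q * y) (q ^ 2 * z) -
        q ^ (2 * k + 3) * detForm q (k + 1) (2 * k + 3) x y z =
      (1 - q ^ (2 * k + 3)) * detForm q k (2 * k + 1) (q ^ 2 * x) (q * y) (q ^ 2 * z) := by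
  unfold detForm
  rw [sum_detTerm_shift h0 h1 z, sum_odd_detTerm_shift h0 h1 z, Finset.sum_range_succ,
    Finset.sum_range_succ]
  simp only [detTerm]
  ring

theorem detForm_even_same {q : ℝ} (k : ℕ) (x y z : ℝ) :
    (1 - q ^ (2 * k + 1)) * detForm q k (2 * k) (q * x) y z =
      detForm q k (2 * k + 1) (q * x) y z - q ^ (2 * k + 1) * detForm q k (2 * k + 1) x y z := by
  unfold detForm
  ring

theorem detForm_even_shift {q : ℝ} (h0 : 0 < q) (h1 : q < 1) (k : ℕ) (y z : ℝ) :
    (1 - q ^ (2 * k + 3)) * detForm q (k + 1) (2 * k + 2) (q * z) (q * y) (q ^ 2 * z) =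
      detForm q (k + 1) (2 * k + 3) (q * z) (q * y) (q ^ 2 * z) -
        q ^ (2 * k + 3) * detForm q (k + 1) (2 * k + 3) z y z := by
  unfold detForm
  rw [sum_detTerm_shift h0 h1 z, sum_odd_detTerm_shift h0 h1 z, Finset.sum_range_succ,
    Finset.sum_range_succ]
  simp only [detTerm]
  ring

theorem detTerm_one (q : ℝ) (j : ℕ) : detTerm q (j + 1) 1 = 0 := by
  simp [detTerm, Finset.prod_range_succ']

theorem detForm_one (q : ℝ) (k n : ℕ) (x : ℝ) : detForm q (k + 1) n x 1 1 = 1 - q := by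
  unfold detForm
  rw [Finset.sum_range_succ', Finset.sum_range_succ']
  simp only [detTerm_one, mul_zero, Finset.sum_const_zero]
  simp [detTerm, oddEvenRatio_zero]

namespace DetRecursion

variable {D : ℕ → ℕ → ℝ} {q : ℝ} {M : ℕ}

theorem odd_closed (h : DetRecursion D q M) (hq0 : 0 < q) (hq1 : q < 1) (k : ℕ) :
    ∀ ν ≤ M, (1 - q) * D (2 * k + 1) ν =
      detForm q k (2 * k + 1) (q ^ ν) (q ^ ((ν + 1) / 2)) (q ^ (2 * ((ν + 1) / 2))) := by
  induction k with
  | zero =>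
    intro ν hν
    simp [h.one_eq hq0 hq1 ν hν, detForm, mul_comm]
  | succ k ih =>
    intro ν
    induction ν using Nat.strong_induction_on with
    | _ ν ihν =>
      intro hν
      rw [show 2 * (k + 1) + 1 = 2 * k + 3 by ring] at ihν ⊢
      have hR := h.odd_eq hq0 hq1 k ν hν
      have hk := ih ν hν
      match ν, ihν, hν, hR, hk with
      | 0, _, _, _, _ => simp [h.zero_right, detForm_one]
      | 1, _, hν, hR, hk =>
        have hF := detForm_odd hq0 hq1 k q⁻¹ 1 1
        rw [detForm_one] at hF
        have e : q ^ 2 * q⁻¹ = q := by field_simp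
        simp only [e, mul_one] at hF
        norm_num [h.zero_right] at hR hk ⊢
        linear_combination (1 - q) * hR - hF + (1 - q ^ (2 * k + 3)) * hk
      | ν + 2, ihν, hν, hR, hk =>
        have hF := detForm_odd hq0 hq1 k (q ^ ν) (q ^ ((ν + 1) / 2)) (q ^ (2 * ((ν + 1) / 2)))
        have h2 := ihν ν (by omega) (by omega)
        have e : (ν + 2 + 1) / 2 = (ν + 1) / 2 + 1 := by omega
        rw [e] at hk ⊢
        rw [show q ^ 2 * q ^ ν = q ^ (ν + 2) by ring,
          show q * q ^ ((ν + 1) / 2) = q ^ ((ν + 1) / 2 + 1) by ring,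
          show q ^ 2 * q ^ (2 * ((ν + 1) / 2)) = q ^ (2 * ((ν + 1) / 2 + 1)) by ring] at hF
        simp only [Nat.add_sub_cancel] at hR
        linear_combination (1 - q) * hR - hF + (1 - q ^ (2 * k + 3)) * hk + q ^ (2 * k + 3) * h2

theorem even_closed (h : DetRecursion D q M) (hq0 : 0 < q) (hq1 : q < 1) (k : ℕ) :
    ∀ ν ≤ M, (1 - q) * D (2 * k + 2) ν =
      detForm q (k + 1) (2 * k + 2) (q ^ ν) (q ^ ((ν + 1) / 2)) (q ^ (2 * ((ν + 1) / 2))) := by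
  intro ν hν
  have hV := h.even_eq hq0 hq1 (k + 1) ν hν
  have h1 := h.odd_closed hq0 hq1 (k + 1) ν hν
  have h2 := h.odd_closed hq0 hq1 (k + 1) (ν - 1) (by omega)
  have hne : 1 - q ^ (2 * k + 3) ≠ 0 := by
    have : q ^ (2 * k + 3) < 1 := pow_lt_one₀ hq0.le hq1 (by omega)
    linarith
  rw [show 2 * (k + 1) + 1 = 2 * k + 3 by ring] at hV h1 h2
  rw [show 2 * (k + 1) = 2 * k + 2 by ring] at hV
  apply mul_left_cancel₀ hne
  rcases Nat.even_or_odd' ν with ⟨m, rfl | rfl⟩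
  · rcases m with _ | m
    · simp [h.zero_right, detForm_one]
    · have hF := detForm_even_same (q := q) (k + 1) (q ^ (2 * m + 1)) (q ^ (m + 1))
        (q ^ (2 * (m + 1)))
      rw [show 2 * (k + 1) + 1 = 2 * k + 3 by ring, show 2 * (k + 1) = 2 * k + 2 by ring] at hF
      rw [show (2 * (m + 1) + 1) / 2 = m + 1 by omega] at h1 ⊢
      rw [show 2 * (m + 1) - 1 = 2 * m + 1 by omega] at h2 hV
      rw [show (2 * m + 1 + 1) / 2 = m + 1 by omega] at h2
      rw [show q * q ^ (2 * m + 1) = q ^ (2 * (m + 1)) by ring] at hF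
      linear_combination (1 - q) * hV - hF + h1 - q ^ (2 * k + 3) * h2
  · have hF := detForm_even_shift hq0 hq1 k (q ^ m) (q ^ (2 * m))
    rw [show (2 * m + 1 + 1) / 2 = m + 1 by omega] at h1 ⊢
    rw [show 2 * m + 1 - 1 = 2 * m by omega] at h2 hV
    rw [show (2 * m + 1) / 2 = m by omega] at h2
    rw [show q * q ^ (2 * m) = q ^ (2 * m + 1) by ring, show q * q ^ m = q ^ (m + 1) by ring,
      show q ^ 2 * q ^ (2 * m) = q ^ (2 * (m + 1)) by ring] at hF
    linear_combination (1 - q) * hV - hF + h1 - q ^ (2 * k + 3) * h2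

theorem closed (h : DetRecursion D q M) (hq0 : 0 < q) (hq1 : q < 1) {n : ℕ} (hn : 1 ≤ n) :
    ∀ ν ≤ M, (1 - q) * D n ν =
      detForm q (n / 2) n (q ^ ν) (q ^ ((ν + 1) / 2)) (q ^ (2 * ((ν + 1) / 2))) := by
  rcases Nat.even_or_odd' n with ⟨m, rfl | rfl⟩
  · obtain ⟨k, rfl⟩ : ∃ k, m = k + 1 := ⟨m - 1, by omega⟩
    rw [show 2 * (k + 1) / 2 = k + 1 by omega, show 2 * (k + 1) = 2 * k + 2 by ring]
    exact h.even_closed hq0 hq1 k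
  · rw [show (2 * m + 1) / 2 = m by omega]
    exact h.odd_closed hq0 hq1 m

end DetRecursion

/-! ### The remainder -/

theorem qPi_add (q : ℝ) (j s : ℕ) :
    qPi (j + s) (q ^ 2) =
      qPi s (q ^ 2) * ∏ i ∈ range j, (1 - q ^ (2 * (s + 1)) * q ^ (2 * i)) := by
  induction j with
  | zero => simp
  | succ j ih =>
    rw [show j + 1 + s = j + s + 1 by ring, qPi_succ, ih, Finset.prod_range_succ, mul_assoc]
    congr 3
    ring

theorem remainder_factor {q : ℝ} (h0 : 0 < q) (h1 : q < 1) (j s : ℕ) :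
    (qPi (2 * j) q * qPi (j + s) (q ^ 2)) / (qPi j (q ^ 2) ^ 2 * qPi s (q ^ 2)) =
      oddEvenRatio q j * ∏ i ∈ range j, (1 - q ^ (2 * (s + 1)) * q ^ (2 * i)) := by
  have hq2 : q ^ 2 < 1 := pow_lt_one₀ h0.le h1 (by norm_num)
  have hs := (qPi_pos (sq_nonneg q) hq2 s).ne'
  have hj := (qPi_pos (sq_nonneg q) hq2 j).ne'
  rw [qPi_add, oddEvenRatio]
  field_simp

theorem detForm_eq_sub_remainder {q : ℝ} (h0 : 0 < q) (h1 : q < 1) (n μ k s : ℕ) :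
    detForm q k n (q ^ μ) (q ^ (s + 1)) (q ^ (2 * (s + 1))) =
      q ^ μ * (1 - q ^ n) - remainderR q n μ k s := by
  unfold detForm remainderR
  simp only [remainder_factor h0 h1]
  have : ∀ j ∈ range k, (q ^ μ * (1 - q ^ n) - q ^ (2 * s + 2) * (1 - q ^ (2 * j + 1))) *
      q ^ (2 * j) * (oddEvenRatio q j *
        ∏ i ∈ range j, (1 - q ^ (2 * (s + 1)) * q ^ (2 * i))) =
      q ^ μ * (1 - q ^ n) * detTerm q j (q ^ (2 * (s + 1))) - q ^ (2 * s + 2) *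
        ((1 - q ^ (2 * j + 1)) * detTerm q j (q ^ (2 * (s + 1)))) := by
    intro j _
    unfold detTerm
    ring
  rw [Finset.sum_congr rfl this, Finset.sum_sub_distrib, ← Finset.mul_sum, ← Finset.mul_sum]
  ring

theorem oddEvenRatio_pos {q : ℝ} (h0 : 0 < q) (h1 : q < 1) (j : ℕ) : 0 < oddEvenRatio q j :=
  div_pos (qPi_pos h0.le h1 _)
    (pow_pos (qPi_pos (sq_nonneg q) (pow_lt_one₀ h0.le h1 (by norm_num)) _) 2)

theorem oddEvenRatio_le_one {q : ℝ} (h0 : 0 < q) (h1 : q < 1) (j : ℕ) : oddEvenRatio q j ≤ 1 := by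
  induction j with
  | zero => rw [oddEvenRatio_zero]
  | succ j ih =>
    have h2 : q ^ (2 * j + 2) < 1 := pow_lt_one₀ h0.le h1 (by omega)
    have h3 := oddEvenRatio_succ h0 h1 j
    have h4 : q ^ (2 * j + 2) ≤ q ^ (2 * j + 1) := pow_le_pow_of_le_one h0.le h1.le (by omega)
    have h5 := oddEvenRatio_pos h0 h1 j
    have h6 : oddEvenRatio q (j + 1) * (1 - q ^ (2 * j + 2)) ≤ 1 * (1 - q ^ (2 * j + 2)) := by
      rw [h3]
      have : q ^ (2 * j + 1) ≤ 1 := pow_le_one₀ h0.le h1.le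
      nlinarith
    exact le_of_mul_le_mul_right h6 (by linarith)

theorem remainder_factor_nonneg {q : ℝ} (h0 : 0 < q) (h1 : q < 1) (j s : ℕ) :
    0 ≤ (qPi (2 * j) q * qPi (j + s) (q ^ 2)) / (qPi j (q ^ 2) ^ 2 * qPi s (q ^ 2)) := by
  have hP := fun n => (qPi_pos (sq_nonneg q) (pow_lt_one₀ h0.le h1 (by norm_num)) n).le
  exact div_nonneg (mul_nonneg (qPi_pos h0.le h1 _).le (hP _))
    (mul_nonneg (pow_nonneg (hP _) 2) (hP _))

theorem remainder_factor_le_one {q : ℝ} (h0 : 0 < q) (h1 : q < 1) (j s : ℕ) :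
    (qPi (2 * j) q * qPi (j + s) (q ^ 2)) / (qPi j (q ^ 2) ^ 2 * qPi s (q ^ 2)) ≤ 1 := by
  rw [remainder_factor h0 h1]
  have hb : ∀ i ∈ range j, 0 ≤ 1 - q ^ (2 * (s + 1)) * q ^ (2 * i) ∧
      1 - q ^ (2 * (s + 1)) * q ^ (2 * i) ≤ 1 := by
    intro i _
    rw [← pow_add]
    have h2 : q ^ (2 * (s + 1) + 2 * i) ≤ 1 := pow_le_one₀ h0.le h1.le
    have h3 : 0 < q ^ (2 * (s + 1) + 2 * i) := pow_pos h0 _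
    constructor <;> linarith
  exact mul_le_one₀ (oddEvenRatio_le_one h0 h1 j) (Finset.prod_nonneg fun i hi => (hb i hi).1)
    (Finset.prod_le_one (fun i hi => (hb i hi).1) fun i hi => (hb i hi).2)

theorem remainder_coeff_nonneg {q : ℝ} (h0 : 0 < q) (h1 : q ≤ 1 / 2) {n μ s j : ℕ}
    (hμ : 1 ≤ μ) (hs : s = (μ - 1) / 2) (hj : j < n / 2) :
    0 ≤ q ^ μ * (1 - q ^ n) - q ^ (2 * s + 2) * (1 - q ^ (2 * j + 1)) := by
  have hn : q ^ n ≤ q ^ (2 * j + 2) := pow_le_pow_of_le_one h0.le (by linarith) (by omega)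
  have hp := pow_pos h0 (2 * j + 2)
  have hm : q ^ (2 * j + 2) = q * q ^ (2 * j + 1) := by ring
  rcases (by omega : μ = 2 * s + 1 ∨ μ = 2 * s + 2) with rfl | rfl
  · rw [show q ^ (2 * s + 1) * (1 - q ^ n) - q ^ (2 * s + 2) * (1 - q ^ (2 * j + 1)) =
      q ^ (2 * s + 1) * (1 - q - q ^ n + q ^ (2 * j + 2)) by ring]
    exact mul_nonneg (pow_pos h0 _).le (by linarith)
  · rw [show q ^ (2 * s + 2) * (1 - q ^ n) - q ^ (2 * s + 2) * (1 - q ^ (2 * j + 1)) =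
      q ^ (2 * s + 2) * (q ^ (2 * j + 1) - q ^ n) by ring]
    have : 0 < q ^ (2 * j + 1) := pow_pos h0 _
    exact mul_nonneg (pow_pos h0 _).le (by nlinarith)

theorem remainderR_nonneg {q : ℝ} (h0 : 0 < q) (h1 : q ≤ 1 / 2) {n μ k s : ℕ} (hμ : 1 ≤ μ)
    (hk : k = n / 2) (hs : s = (μ - 1) / 2) : 0 ≤ remainderR q n μ k s := by
  refine mul_nonneg (pow_pos h0 _).le (Finset.sum_nonneg fun j hj => ?_)
  have hj' : j < n / 2 := by rw [← hk]; exact Finset.mem_range.1 hj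
  exact mul_nonneg (mul_nonneg (remainder_coeff_nonneg h0 h1 hμ hs hj') (pow_pos h0 _).le)
    (remainder_factor_nonneg h0 (by linarith) j s)

theorem geom_sum_le {r : ℝ} (h0 : 0 ≤ r) (h1 : r < 1) (k : ℕ) :
    ∑ j ∈ range k, r ^ j ≤ (1 - r)⁻¹ := by
  rw [← tsum_geometric_of_lt_one h0 h1]
  exact (summable_geometric_of_lt_one h0 h1).sum_le_tsum _ fun i _ => pow_nonneg h0 i

theorem remainderR_le {q : ℝ} (h0 : 0 < q) (h1 : q ≤ 1 / 2) {n μ k s : ℕ} (hμ : 1 ≤ μ)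
    (hk : k = n / 2) (hs : s = (μ - 1) / 2) :
    remainderR q n μ k s ≤ q ^ (s + 1) * ∑ j ∈ range k,
      (q ^ μ - q ^ (2 * s + 2) * (1 - q ^ (2 * j + 1))) * q ^ (2 * j) := by
  refine mul_le_mul_of_nonneg_left (Finset.sum_le_sum fun j hj => ?_) (pow_pos h0 _).le
  have hj' : j < n / 2 := by rw [← hk]; exact Finset.mem_range.1 hj
  have hq := pow_pos h0 (2 * j)
  refine (mul_le_of_le_one_right (mul_nonneg (remainder_coeff_nonneg h0 h1 hμ hs hj') hq.le)
    (remainder_factor_le_one h0 (by linarith) j s)).trans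
    (mul_le_mul_of_nonneg_right ?_ hq.le)
  have : 0 < q ^ μ * q ^ n := by positivity
  linarith

theorem remainderR_lt {q : ℝ} (h0 : 0 < q) (h1 : q ≤ 1 / 2) {n μ k s : ℕ} (hμ : 1 ≤ μ)
    (hk : k = n / 2) (hs : s = (μ - 1) / 2) :
    remainderR q n μ k s < q ^ ((3 * (μ : ℝ)) / 2) := by
  refine (remainderR_le h0 h1 hμ hk hs).trans_lt ?_
  have hq2 : q ^ 2 < 1 := pow_lt_one₀ h0.le (by linarith) (by norm_num)
  have hq4 : q ^ 4 < 1 := pow_lt_one₀ h0.le (by linarith) (by norm_num)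
  have g2 := geom_sum_le (sq_nonneg q) hq2 k
  have g4 := geom_sum_le (by positivity : 0 ≤ q ^ 4) hq4 k
  have hq4' : q ^ 4 ≤ 1 / 16 := by
    calc q ^ 4 ≤ (1 / 2) ^ 4 := pow_le_pow_left₀ h0.le h1 4
      _ = 1 / 16 := by norm_num
  have hq2' : q ^ 2 ≤ 1 / 4 := by
    calc q ^ 2 ≤ (1 / 2) ^ 2 := pow_le_pow_left₀ h0.le h1 2
      _ = 1 / 4 := by norm_num
  have i4 : (1 - q ^ 4)⁻¹ ≤ 16 / 15 := by
    rw [inv_le_comm₀ (by linarith) (by norm_num)]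
    norm_num
    linarith
  have i2 : (1 - q) * (1 - q ^ 2)⁻¹ = (1 + q)⁻¹ := by
    have h2 : 1 - q ≠ 0 := by linarith
    have h3 : 1 + q ≠ 0 := by linarith
    rw [show 1 - q ^ 2 = (1 - q) * (1 + q) by ring]
    field_simp
  rcases (by omega : μ = 2 * s + 1 ∨ μ = 2 * s + 2) with hm | hm
  · have hle : ∑ j ∈ range k, (q ^ μ - q ^ (2 * s + 2) * (1 - q ^ (2 * j + 1))) * q ^ (2 * j) =
        q ^ (2 * s + 1) * ((1 - q) * ∑ j ∈ range k, (q ^ 2) ^ j +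
          q ^ 2 * ∑ j ∈ range k, (q ^ 4) ^ j) := by
      rw [Finset.mul_sum, Finset.mul_sum, ← Finset.sum_add_distrib, Finset.mul_sum]
      refine Finset.sum_congr rfl fun j _ => ?_
      rw [hm, ← pow_mul, ← pow_mul]
      ring
    rw [hle, ← mul_assoc, ← pow_add]
    have hb : (1 - q) * ∑ j ∈ range k, (q ^ 2) ^ j + q ^ 2 * ∑ j ∈ range k, (q ^ 4) ^ j ≤ 1 := by
      have a1 := mul_le_mul_of_nonneg_left g2 (by linarith : 0 ≤ 1 - q)
      have a2 := mul_le_mul_of_nonneg_left (g4.trans i4) (sq_nonneg q)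
      rw [i2] at a1
      have a3 : (1 + q)⁻¹ ≤ 1 - 16 / 15 * q ^ 2 := by
        rw [inv_le_iff_one_le_mul₀ (by linarith)]
        nlinarith [mul_nonneg h0.le (by linarith : 0 ≤ 1 / 2 - q),
          mul_nonneg h0.le (by linarith : (0 : ℝ) ≤ 1 / 4 - q ^ 2)]
      linarith
    calc _ ≤ q ^ (s + 1 + (2 * s + 1)) * 1 :=
          mul_le_mul_of_nonneg_left hb (pow_pos h0 _).le
      _ = q ^ (((s + 1 + (2 * s + 1) : ℕ) : ℝ)) := by rw [mul_one, Real.rpow_natCast]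
      _ < _ := Real.rpow_lt_rpow_of_exponent_gt h0 (by linarith) (by
          rw [hm]; push_cast; linarith)
  · have hle : ∑ j ∈ range k, (q ^ μ - q ^ (2 * s + 2) * (1 - q ^ (2 * j + 1))) * q ^ (2 * j) =
        q ^ (2 * s + 2) * (q * ∑ j ∈ range k, (q ^ 4) ^ j) := by
      rw [Finset.mul_sum, Finset.mul_sum]
      refine Finset.sum_congr rfl fun j _ => ?_
      rw [hm, ← pow_mul]
      ring
    rw [hle, ← mul_assoc, ← pow_add]
    have hb : q * ∑ j ∈ range k, (q ^ 4) ^ j < 1 := by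
      have a2 := mul_le_mul_of_nonneg_left (g4.trans i4) h0.le
      linarith
    calc _ < q ^ (s + 1 + (2 * s + 2)) * 1 := mul_lt_mul_of_pos_left hb (pow_pos h0 _)
      _ = q ^ (((s + 1 + (2 * s + 2) : ℕ) : ℝ)) := by rw [mul_one, Real.rpow_natCast]
      _ = _ := by
        congr 1
        rw [hm]
        push_cast
        ring

/-! ### Averages over finite groups -/

theorem expect_eq_of_eq_off_range {G : Type*} [AddCommGroup G] [Fintype G] (φ : G →+ G) (f : G → ℝ)
    (c : ℝ) (hf : ∀ x, x ∉ φ.range → f x = c) :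
    𝔼 x, f x = (1 - (Nat.card φ.range : ℝ) / Nat.card G) * c +
      (Nat.card φ.range : ℝ) / Nat.card G * 𝔼 y, f (φ y) := by
  classical
  set k : ℕ := #{g | φ g = 0} with hk
  have hfib : ∀ x ∈ (univ : Finset G).image φ, #{g | φ g = x} = k := by
    intro x hx
    obtain ⟨y, -, rfl⟩ := Finset.mem_image.1 hx
    exact AddMonoidHom.card_fiber_eq_of_mem_range φ ⟨y, rfl⟩ ⟨0, map_zero φ⟩
  have hsum : ∀ g : G → ℝ, ∑ y, g (φ y) = k * ∑ x ∈ (univ : Finset G).image φ, g x := by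
    intro g
    rw [Finset.sum_comp g φ, Finset.mul_sum]
    exact Finset.sum_congr rfl fun x hx => by rw [hfib x hx, nsmul_eq_mul]
  have hr : Nat.card φ.range = #((univ : Finset G).image φ) := by
    rw [← Set.ncard_coe_finset, Finset.coe_image, Finset.coe_univ, Set.image_univ]
    rfl
  have hcard := hsum fun _ => 1
  simp only [Finset.sum_const, nsmul_eq_mul, mul_one, Finset.card_univ] at hcard
  have hG : (Fintype.card G : ℝ) ≠ 0 := by positivity
  have htot : ∑ x, f x = ∑ x ∈ (univ : Finset G).image φ, f x +
      (Fintype.card G - #((univ : Finset G).image φ)) * c := by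
    rw [← Finset.sum_add_sum_compl ((univ : Finset G).image φ) f,
      Finset.sum_congr rfl (g := fun _ => c) (s₁ := ((univ : Finset G).image φ)ᶜ), Finset.sum_const,
      nsmul_eq_mul, Finset.card_compl, Nat.cast_sub (Finset.card_le_univ _)]
    intro x hx
    refine hf x fun ⟨y, hy⟩ => ?_
    exact (Finset.mem_compl.1 hx) (Finset.mem_image.2 ⟨y, Finset.mem_univ _, hy⟩)
  rw [Fintype.expect_eq_sum_div_card, Fintype.expect_eq_sum_div_card, hsum f, htot, hr,
    Nat.card_eq_fintype_card]
  field_simp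
  rw [hcard]
  ring

/-! ### Uniformizers in finite rings -/

/-- `π` behaves in the finite ring `R` like the class of `p` in `ℤ / p ^ M`, where `q = 1 / p`. -/
structure IsTruncUniformizer {R : Type*} [CommRing R] (π : R) (q : ℝ) (M : ℕ) : Prop where
  isUnit_iff : ∀ x : R, IsUnit x ↔ ¬ π ∣ x
  pow_dvd_mul : ∀ ν ≤ M, ∀ d : R, π ^ ν ∣ π * d ↔ π ^ (ν - 1) ∣ d
  card : (Nat.card {x : R // π ∣ x} : ℝ) = q * Nat.card R

section Ring

variable {R : Type*} [CommRing R] {π : R} {q : ℝ} {M : ℕ}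

namespace IsTruncUniformizer

theorem isUnit_mul_sub_mul (h : IsTruncUniformizer π q M) {a b : R} (ha : π ∣ a) (hb : IsUnit b)
    (c : R) : IsUnit (a * c - b * b) := by
  rw [h.isUnit_iff]
  intro hd
  have h1 : π ∣ b * b := by
    have := dvd_sub (ha.mul_right c) hd
    rwa [sub_sub_cancel] at this
  exact (h.isUnit_iff _).1 (hb.mul hb) h1

variable [Fintype R]

theorem card_div (h : IsTruncUniformizer π q M) :
    (Nat.card {x : R // π ∣ x} : ℝ) / Nat.card R = q := by
  have : (Nat.card R : ℝ) ≠ 0 := by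
    rw [Nat.card_eq_fintype_card]
    positivity
  rw [h.card]
  field_simp

theorem expect_scalar (h : IsTruncUniformizer π q M) (f : R → ℝ) (c : ℝ)
    (hf : ∀ x, IsUnit x → f x = c) :
    𝔼 x, f x = (1 - q) * c + q * 𝔼 y, f (π * y) := by
  have hmem : ∀ x, x ∈ (AddMonoidHom.mulLeft π).range ↔ π ∣ x := fun x =>
    ⟨fun ⟨y, hy⟩ => ⟨y, hy.symm⟩, fun ⟨y, hy⟩ => ⟨y, hy.symm⟩⟩
  have hc : Nat.card (AddMonoidHom.mulLeft π).range = Nat.card {x : R // π ∣ x} :=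
    Nat.card_congr (Equiv.subtypeEquivRight hmem)
  have := expect_eq_of_eq_off_range (AddMonoidHom.mulLeft π) f c fun x hx =>
    hf x ((h.isUnit_iff x).2 fun hd => hx ((hmem x).2 hd))
  rw [hc, h.card_div] at this
  exact this

theorem expect_vector (h : IsTruncUniformizer π q M) {κ : Type*} [Fintype κ] [DecidableEq κ]
    (f : (κ → R) → ℝ) (c : ℝ) (hf : ∀ v, (∃ j, IsUnit (v j)) → f v = c) :
    𝔼 v, f v = (1 - q ^ Fintype.card κ) * c + q ^ Fintype.card κ * 𝔼 v : κ → R, f (π • v) := by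
  have hmem : ∀ v, v ∈ ((AddMonoidHom.mulLeft π).compLeft κ).range ↔ ∀ i, π ∣ v i := fun v =>
    ⟨fun ⟨y, hy⟩ i => ⟨y i, (congrFun hy i).symm⟩, fun hv => by
      choose y hy using hv
      exact ⟨y, funext fun i => (hy i).symm⟩⟩
  have hc : Nat.card ((AddMonoidHom.mulLeft π).compLeft κ).range =
      Nat.card {x : R // π ∣ x} ^ Fintype.card κ := by
    rw [Nat.card_congr ((Equiv.subtypeEquivRight hmem).trans Equiv.subtypePiEquivPi),
      Nat.card_fun, Nat.card_eq_fintype_card (α := κ)]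
  have := expect_eq_of_eq_off_range ((AddMonoidHom.mulLeft π).compLeft κ) f c fun v hv =>
    hf v (by
      by_contra hne
      push Not at hne
      exact hv ((hmem v).2 fun i => by
        by_contra hd
        exact hne i ((h.isUnit_iff _).2 hd)))
  rw [hc, Nat.card_fun, Nat.card_eq_fintype_card (α := κ), Nat.cast_pow, Nat.cast_pow, ← div_pow,
    h.card_div] at this
  exact this

end IsTruncUniformizer

end Ring

/-! ### Random symmetric matrices -/

/-- The symmetric matrices with index type `κ` and entries in `R`. -/
def SymMat (κ R : Type*) := {A : Matrix κ κ R // A.IsSymm}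

noncomputable instance {κ R : Type*} [Finite κ] [Finite R] : Fintype (SymMat κ R) :=
  have : Finite (Matrix κ κ R) := inferInstanceAs (Finite (κ → κ → R))
  have : Finite (SymMat κ R) := inferInstanceAs (Finite {A : Matrix κ κ R // A.IsSymm})
  Fintype.ofFinite _

namespace SymMat

variable {κ κ' : Type*}

/-- Relabelling of the rows and columns. -/
def reindex (R : Type*) (e : κ ≃ κ') : SymMat κ R ≃ SymMat κ' R where
  toFun A := ⟨A.1.submatrix e.symm e.symm, A.2.submatrix _⟩
  invFun A := ⟨A.1.submatrix e e, A.2.submatrix _⟩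
  left_inv A := Subtype.ext (by ext; simp)
  right_inv A := Subtype.ext (by ext; simp)

/-- Translation by a symmetric matrix. -/
def translate {R : Type*} [AddCommGroup R] {S : Matrix κ κ R} (hS : S.IsSymm) : SymMat κ R ≃ SymMat κ R where
  toFun A := ⟨A.1 - S, A.2.sub hS⟩
  invFun A := ⟨A.1 + S, A.2.add hS⟩
  left_inv _ := Subtype.ext (sub_add_cancel _ _)
  right_inv _ := Subtype.ext (add_sub_cancel_right _ _)

end SymMat

/-- The symmetric matrix with first row `(a, v)` and remaining block `C`. -/
def bordered {κ R : Type*} (a : R) (v : κ → R) (C : Matrix κ κ R) : Matrix (Unit ⊕ κ) (Unit ⊕ κ) R :=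
  Matrix.fromBlocks (Matrix.of fun _ _ => a) (Matrix.replicateRow Unit v)
    (Matrix.replicateCol Unit v) C

theorem bordered_isSymm {κ R : Type*} (a : R) (v : κ → R) {C : Matrix κ κ R} (hC : C.IsSymm) :
    (bordered a v C).IsSymm :=
  Matrix.IsSymm.fromBlocks (by ext; rfl) (by ext; rfl) hC

/-- Splitting off the first row of a symmetric matrix. -/
def borderedEquiv (κ R : Type*) : R × (κ → R) × SymMat κ R ≃ SymMat (Unit ⊕ κ) R where
  toFun x := ⟨bordered x.1 x.2.1 x.2.2.1, bordered_isSymm _ _ x.2.2.2⟩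
  invFun A := ⟨A.1 (Sum.inl ()) (Sum.inl ()), fun i => A.1 (Sum.inl ()) (Sum.inr i),
    ⟨A.1.submatrix Sum.inr Sum.inr, A.2.submatrix _⟩⟩
  left_inv x := rfl
  right_inv A := Subtype.ext (by
    ext i j
    rcases i with i | i <;> rcases j with j | j
    · rfl
    · rfl
    · exact A.2.apply _ _
    · rfl)

section Ring

variable {R : Type*} [CommRing R] {π : R} {q : ℝ} {M : ℕ}

open scoped Classical in
/-- The indicator function of divisibility by `π ^ ν`. -/
noncomputable def dvdInd (π : R) (ν : ℕ) (d : R) : ℝ := if π ^ ν ∣ d then 1 else 0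

theorem dvdInd_congr {ν ν' : ℕ} {d d' : R} (h : π ^ ν ∣ d ↔ π ^ ν' ∣ d') :
    dvdInd π ν d = dvdInd π ν' d' := by
  classical
  unfold dvdInd
  exact if_congr h rfl rfl

theorem dvdInd_unit_mul {u : R} (hu : IsUnit u) (ν : ℕ) (d : R) :
    dvdInd π ν (u * d) = dvdInd π ν d :=
  dvdInd_congr hu.dvd_mul_left

theorem det_unit_sum_unit (B : Matrix (Unit ⊕ Unit) (Unit ⊕ Unit) R) :
    B.det = B (Sum.inl ()) (Sum.inl ()) * B (Sum.inr ()) (Sum.inr ()) -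
      B (Sum.inl ()) (Sum.inr ()) * B (Sum.inr ()) (Sum.inl ()) := by
  rw [← Matrix.det_submatrix_equiv_self (finTwoEquiv.trans Equiv.boolEquivPUnitSumPUnit) B,
    Matrix.det_fin_two]
  rfl

variable {κ : Type*} [Fintype κ] [DecidableEq κ]

theorem det_bordered_smul_of_dvd (y : R) (v : κ → R) (C : Matrix κ κ R) :
    (bordered (π * y) (π • v) C).det =
      π * (Matrix.fromBlocks (Matrix.of fun _ _ : Unit => y) (Matrix.replicateRow Unit v)
        (π • (Matrix.replicateRow Unit v).transpose) C).det := by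
  have : bordered (π * y) (π • v) C =
      Matrix.fromBlocks (Matrix.of fun _ _ : Unit => π) 0 0 1 *
        Matrix.fromBlocks (Matrix.of fun _ _ : Unit => y) (Matrix.replicateRow Unit v)
        (π • (Matrix.replicateRow Unit v).transpose) C := by
    rw [Matrix.fromBlocks_multiply]
    simp only [Matrix.zero_mul, Matrix.one_mul, add_zero, zero_add]
    ext i j
    rcases i with i | i <;> rcases j with j | j <;> simp [bordered, Matrix.mul_apply]
  rw [this, Matrix.det_mul, Matrix.det_fromBlocks_zero₂₁]
  simp

theorem det_bordered_smul_smul (y : R) (v : κ → R) (C : Matrix κ κ R) :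
    (bordered (π * (π * y)) (π • v) C).det = π * (π * (bordered y v C).det) := by
  rw [det_bordered_smul_of_dvd]
  congr 1
  have : Matrix.fromBlocks (Matrix.of fun _ _ : Unit => π * y) (Matrix.replicateRow Unit v)
        (π • (Matrix.replicateRow Unit v).transpose) C =
      bordered y v C * Matrix.fromBlocks (Matrix.of fun _ _ : Unit => π) 0 0 1 := by
    rw [bordered, Matrix.fromBlocks_multiply]
    simp only [Matrix.mul_zero, Matrix.mul_one, add_zero, zero_add]
    ext i j
    rcases i with i | i <;> rcases j with j | j <;>
      simp [Matrix.mul_apply, mul_comm]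
  rw [this, Matrix.det_mul, Matrix.det_fromBlocks_zero₂₁, mul_comm]
  simp

variable [Fintype R]

/-- The probability that `π ^ ν` divides the determinant of a random symmetric matrix. -/
noncomputable def divProb (π : R) (κ : Type*) [Fintype κ] [DecidableEq κ] (ν : ℕ) : ℝ :=
  𝔼 A : SymMat κ R, dvdInd π ν A.1.det

/-- The probability that `π ^ ν` divides the determinant of a random symmetric matrix with
first row `(a, v)`. -/
noncomputable def borderedProb (π : R) (ν : ℕ) (a : R) (v : κ → R) : ℝ :=
  𝔼 C : SymMat κ R, dvdInd π ν (bordered a v C.1).det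

theorem divProb_congr {κ' : Type*} [Fintype κ'] [DecidableEq κ'] (e : κ ≃ κ') (ν : ℕ) :
    divProb π κ ν = divProb π κ' ν :=
  Fintype.expect_equiv (SymMat.reindex R e) _ _ fun A => by
    exact congrArg _ (Matrix.det_submatrix_equiv_self e.symm A.1).symm

theorem expect_bordered {κ R : Type*} [Fintype κ] [DecidableEq κ] [Fintype R]
    (f : Matrix (Unit ⊕ κ) (Unit ⊕ κ) R → ℝ) :
    𝔼 A : SymMat (Unit ⊕ κ) R, f A.1 =
      𝔼 a : R, 𝔼 v : κ → R, 𝔼 C : SymMat κ R, f (bordered a v C.1) := by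
  classical
  rw [← Fintype.expect_equiv (borderedEquiv κ R) (fun x => f (bordered x.1 x.2.1 x.2.2.1)) _
    fun x => rfl, ← Finset.univ_product_univ, Finset.expect_product]
  refine Finset.expect_congr rfl fun a _ => ?_
  rw [← Finset.univ_product_univ, Finset.expect_product]

theorem divProb_unit_sum (ν : ℕ) :
    divProb π (Unit ⊕ κ) ν = 𝔼 a : R, 𝔼 v : κ → R, borderedProb π ν a v :=
  expect_bordered fun A => dvdInd π ν A.det

/-- Averaging over the last block, a block matrix with invertible symmetric first block may be
replaced by its last block. -/
theorem expect_det_fromBlocks {α : Type*} [Fintype α] [DecidableEq α] {B : Matrix α α R}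
    (hB : IsUnit B.det) (hBs : B.IsSymm) (X : Matrix α κ R) (c : R) (ν : ℕ) :
    𝔼 C : SymMat κ R, dvdInd π ν (Matrix.fromBlocks B X (c • X.transpose) C.1).det =
      divProb π κ ν := by
  have := B.invertibleOfIsUnitDet hB
  have hBi : (⅟B).IsSymm := by
    rw [Matrix.invOf_eq_nonsing_inv]
    exact hBs.inv
  have hS : (c • X.transpose * ⅟B * X).IsSymm := by
    rw [Matrix.smul_mul, Matrix.smul_mul]
    refine Matrix.IsSymm.smul ?_ c
    rw [Matrix.IsSymm, Matrix.transpose_mul, Matrix.transpose_mul, hBi.eq,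
      Matrix.transpose_transpose, Matrix.mul_assoc]
  refine Fintype.expect_equiv (SymMat.translate hS) _ _ fun C => ?_
  rw [Matrix.det_fromBlocks₁₁, dvdInd_unit_mul hB]
  rfl

theorem borderedProb_of_isUnit {a : R} (ha : IsUnit a) (v : κ → R) (ν : ℕ) :
    borderedProb π ν a v = divProb π κ ν := by
  have h := expect_det_fromBlocks (π := π) (κ := κ) (B := Matrix.of fun _ _ : Unit => a)
    (by simpa using ha) (by ext; rfl) (Matrix.replicateRow Unit v) 1 ν
  rw [one_smul] at h
  exact h

theorem borderedProb_congr {κ' : Type*} [Fintype κ'] [DecidableEq κ'] (e : κ ≃ κ') (ν : ℕ) (a : R)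
    (v : κ → R) : borderedProb π ν a v = borderedProb π ν a (v ∘ e.symm) := by
  refine Fintype.expect_equiv (SymMat.reindex R e) _ _ fun C => ?_
  rw [← Matrix.det_submatrix_equiv_self (Equiv.sumCongr (Equiv.refl Unit) e.symm)
    (bordered a v C.1)]
  congr 2
  ext i j
  rcases i with i | i <;> rcases j with j | j <;> rfl

theorem IsTruncUniformizer.borderedProb_sum (h : IsTruncUniformizer π q M) {a : R} (ha : π ∣ a)
    (v : Unit ⊕ κ → R) (hv : IsUnit (v (Sum.inl ()))) (ν : ℕ) :
    borderedProb π ν a v = divProb π κ ν := by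
  have hne : Nonempty R := ⟨0⟩
  unfold borderedProb
  rw [expect_bordered fun A => dvdInd π ν (bordered a v A).det]
  refine (Finset.expect_congr rfl fun c _ => ?_).trans (Fintype.expect_const _)
  refine (Finset.expect_congr rfl fun w _ => ?_).trans (Fintype.expect_const _)
  rw [← expect_det_fromBlocks
    (B := bordered a (fun _ : Unit => v (Sum.inl ())) (Matrix.of fun _ _ => c))
    (by rw [det_unit_sum_unit]; exact h.isUnit_mul_sub_mul ha hv c)
    (bordered_isSymm _ _ (by ext; rfl))
    (Matrix.of (Sum.elim (fun _ i => v (Sum.inr i)) fun _ => w)) 1 ν]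
  refine Finset.expect_congr rfl fun C _ => ?_
  rw [one_smul, ← Matrix.det_submatrix_equiv_self (Equiv.sumAssoc Unit Unit κ)]
  congr 2
  ext i j
  rcases i with (i | i) | i <;> rcases j with (j | j) | j <;> rfl

theorem IsTruncUniformizer.borderedProb_of_dvd (h : IsTruncUniformizer π q M) {a : R} (ha : π ∣ a)
    (v : κ → R) (hv : ∃ j, IsUnit (v j)) (ν : ℕ) :
    borderedProb π ν a v = divProb π (Fin (Fintype.card κ - 1)) ν := by
  obtain ⟨j, hj⟩ := hv
  let e : κ ≃ Unit ⊕ {i // i ≠ j} :=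
    (Equiv.sumCompl (· = j)).symm.trans (Equiv.sumCongr (Equiv.ofUnique _ _) (Equiv.refl _))
  have he : e.symm (Sum.inl ()) = j := (default : {i // i = j}).2
  rw [borderedProb_congr e, h.borderedProb_sum ha _ (by simpa [he] using hj)]
  exact divProb_congr (Fintype.equivFinOfCardEq (by
    rw [Fintype.card_subtype_compl, Fintype.card_subtype_eq])) ν

theorem IsTruncUniformizer.borderedProb_smul_of_isUnit (h : IsTruncUniformizer π q M) {y : R}
    (hy : IsUnit y) (v : κ → R) {ν : ℕ} (hν : ν ≤ M) :
    borderedProb π ν (π * y) (π • v) = divProb π κ (ν - 1) := by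
  rw [← expect_det_fromBlocks (π := π) (κ := κ) (B := Matrix.of fun _ _ : Unit => y)
    (by simpa using hy) (by ext; rfl) (Matrix.replicateRow Unit v) π (ν - 1)]
  refine Finset.expect_congr rfl fun C _ => ?_
  rw [det_bordered_smul_of_dvd]
  exact dvdInd_congr (h.pow_dvd_mul ν hν _)

theorem IsTruncUniformizer.borderedProb_smul_smul (h : IsTruncUniformizer π q M) (y : R)
    (v : κ → R) {ν : ℕ} (hν : ν ≤ M) :
    borderedProb π ν (π * (π * y)) (π • v) = borderedProb π (ν - 2) y v := by
  refine Finset.expect_congr rfl fun C _ => ?_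
  rw [det_bordered_smul_smul]
  exact dvdInd_congr ((h.pow_dvd_mul ν hν _).trans (h.pow_dvd_mul (ν - 1) (by omega) _))

theorem IsTruncUniformizer.divProb_unit_sum_eq (h : IsTruncUniformizer π q M) {ν : ℕ}
    (hν : ν ≤ M) :
    divProb π (Unit ⊕ κ) ν = (1 - q) * divProb π κ ν +
      q * (1 - q ^ Fintype.card κ) * divProb π (Fin (Fintype.card κ - 1)) ν +
      q ^ (Fintype.card κ + 1) * ((1 - q) * divProb π κ (ν - 1) +
        q * divProb π (Unit ⊕ κ) (ν - 2)) := by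
  have hne : Nonempty R := ⟨0⟩
  rw [divProb_unit_sum ν, h.expect_scalar _ (divProb π κ ν) fun a ha => by
    simp_rw [borderedProb_of_isUnit ha]
    exact Fintype.expect_const _]
  have h1 : ∀ y : R, 𝔼 v : κ → R, borderedProb π ν (π * y) v =
      (1 - q ^ Fintype.card κ) * divProb π (Fin (Fintype.card κ - 1)) ν +
        q ^ Fintype.card κ * 𝔼 v : κ → R, borderedProb π ν (π * y) (π • v) := fun y =>
    h.expect_vector _ _ fun v hv => h.borderedProb_of_dvd (dvd_mul_right _ _) v hv ν
  have h2 : 𝔼 y : R, 𝔼 v : κ → R, borderedProb π ν (π * y) (π • v) =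
      (1 - q) * divProb π κ (ν - 1) + q * divProb π (Unit ⊕ κ) (ν - 2) := by
    rw [h.expect_scalar _ (divProb π κ (ν - 1)) fun y hy => by
      simp_rw [h.borderedProb_smul_of_isUnit hy _ hν]
      exact Fintype.expect_const _]
    simp_rw [h.borderedProb_smul_smul _ _ hν, divProb_unit_sum]
  simp_rw [h1]
  rw [Finset.expect_add_distrib, Fintype.expect_const, ← Finset.mul_expect, h2]
  ring

theorem divProb_zero_right (π : R) (κ : Type*) [Fintype κ] [DecidableEq κ] : divProb π κ 0 = 1 := by
  have : Nonempty (SymMat κ R) := ⟨⟨0, Matrix.isSymm_zero⟩⟩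
  simp [divProb, dvdInd]

theorem IsTruncUniformizer.detRecursion (h : IsTruncUniformizer π q M)
    (hM : ∀ ν, 1 ≤ ν → ν ≤ M → ¬ π ^ ν ∣ 1) :
    DetRecursion (fun n ν => divProb π (Fin n) ν) q M where
  zero_right n := divProb_zero_right π _
  zero_left ν h1 h2 := by simp [divProb, dvdInd, hM ν h1 h2]
  step n ν hν := by
    have e : Unit ⊕ Fin n ≃ Fin (n + 1) := Fintype.equivFinOfCardEq (by simp [add_comm])
    have := h.divProb_unit_sum_eq (κ := Fin n) hν
    rw [divProb_congr e, divProb_congr e, Fintype.card_fin] at this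
    exact this

end Ring

/-! ### The ring of integers modulo a prime power -/

theorem zmod_pow_dvd_intCast {p M ν : ℕ} (hν : ν ≤ M) (d : ℤ) :
    (p : ZMod (p ^ M)) ^ ν ∣ (d : ZMod (p ^ M)) ↔ (p : ℤ) ^ ν ∣ d := by
  constructor
  · rintro ⟨c, hc⟩
    obtain ⟨c, rfl⟩ := ZMod.intCast_surjective c
    have h0 : ((d - p ^ ν * c : ℤ) : ZMod (p ^ M)) = 0 := by
      push_cast
      rw [hc, sub_self]
    rw [ZMod.intCast_zmod_eq_zero_iff_dvd] at h0
    have h1 : (p : ℤ) ^ ν ∣ d - p ^ ν * c := by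
      refine (pow_dvd_pow _ hν).trans ?_
      exact_mod_cast h0
    simpa using dvd_add h1 (dvd_mul_right _ c)
  · intro h
    have := map_dvd (Int.castRingHom (ZMod (p ^ M))) h
    simpa using this

theorem zmod_isTruncUniformizer {p M : ℕ} (hp : p.Prime) (hM : 1 ≤ M) :
    IsTruncUniformizer (p : ZMod (p ^ M)) (1 / (p : ℝ)) M := by
  have : NeZero p := ⟨hp.ne_zero⟩
  have hu : ∀ x : ZMod (p ^ M), IsUnit x ↔ ¬ (p : ZMod (p ^ M)) ∣ x := by
    intro x
    have h1 := zmod_pow_dvd_intCast (p := p) hM (x.val : ℤ)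
    rw [pow_one, pow_one, Int.natCast_dvd_natCast, Int.cast_natCast, ZMod.natCast_zmod_val] at h1
    rw [h1, ← hp.coprime_iff_not_dvd, ← Nat.coprime_pow_left_iff hM, Nat.coprime_comm,
      ← ZMod.isUnit_iff_coprime, ZMod.natCast_zmod_val]
  refine ⟨hu, fun ν hν d => ?_, ?_⟩
  · obtain ⟨d, rfl⟩ := ZMod.intCast_surjective d
    rcases Nat.eq_zero_or_pos ν with rfl | hpos
    · simp
    · obtain ⟨ν, rfl⟩ : ∃ k, ν = k + 1 := ⟨ν - 1, by omega⟩
      have h1 := zmod_pow_dvd_intCast (p := p) hν (p * d)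
      rw [Nat.add_sub_cancel, zmod_pow_dvd_intCast (by omega)]
      rw [Int.cast_mul, Int.cast_natCast] at h1
      rw [h1, pow_succ']
      exact mul_dvd_mul_iff_left (by exact_mod_cast hp.ne_zero)
  · classical
    have h1 : Fintype.card {x : ZMod (p ^ M) // IsUnit x} = p ^ (M - 1) * (p - 1) := by
      rw [← Nat.totient_prime_pow hp hM, ← ZMod.card_units_eq_totient]
      let e : (ZMod (p ^ M))ˣ ≃ {x : ZMod (p ^ M) // IsUnit x} :=
        Equiv.ofBijective (fun u => ⟨u, u.isUnit⟩)
          ⟨fun u v h => Units.ext (congrArg Subtype.val h), fun ⟨_, u, hu⟩ => ⟨u, Subtype.ext hu⟩⟩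
      exact (Fintype.card_congr e).symm
    have h2 : Fintype.card {x : ZMod (p ^ M) // ¬ IsUnit x} = p ^ (M - 1) := by
      rw [Fintype.card_subtype_compl, h1, ZMod.card]
      obtain ⟨k, rfl⟩ : ∃ k, M = k + 1 := ⟨M - 1, by omega⟩
      obtain ⟨r, rfl⟩ : ∃ r, p = r + 1 := ⟨p - 1, by have := hp.pos; omega⟩
      simp only [Nat.add_sub_cancel]
      rw [pow_succ, mul_add, mul_one, Nat.add_sub_cancel_left]
    have h3 : Nat.card {x : ZMod (p ^ M) // (p : ZMod (p ^ M)) ∣ x} = p ^ (M - 1) := by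
      rw [← h2, ← Nat.card_eq_fintype_card]
      exact Nat.card_congr (Equiv.subtypeEquivRight fun x => by rw [hu, not_not])
    have hp0 : (p : ℝ) ≠ 0 := by exact_mod_cast hp.ne_zero
    rw [h3, Nat.card_zmod]
    obtain ⟨k, rfl⟩ : ∃ k, M = k + 1 := ⟨M - 1, by omega⟩
    push_cast
    simp only [pow_succ]
    field_simp

theorem zmod_detRecursion {p M : ℕ} [NeZero p] (hp : p.Prime) (hM : 1 ≤ M) :
    DetRecursion (fun n ν => divProb (p : ZMod (p ^ M)) (Fin n) ν) (1 / (p : ℝ)) M := by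
  refine (zmod_isTruncUniformizer hp hM).detRecursion fun ν h1 h2 hd => ?_
  have h3 := (zmod_pow_dvd_intCast (p := p) h2 1).1 (by simpa using hd)
  have h4 : (p : ℤ) ∣ 1 := (dvd_pow_self _ (by omega)).trans h3
  exact hp.one_lt.ne' (by exact_mod_cast Int.eq_one_of_dvd_one (by positivity) h4)

/-! ### The `m`-rank -/

theorem mRank_eq_iff {m n : ℕ} (hn : 1 ≤ n) (A : Matrix (Fin n) (Fin n) (ZMod m)) :
    mRank A = n ↔ A.det ≠ 0 := by
  have hb : ∀ k ∈ {k : ℕ | ∃ r c : Fin k ↪o Fin n, (A.submatrix r c).det ≠ 0}, k ≤ n := by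
    rintro k ⟨r, -⟩
    simpa using Fintype.card_le_of_embedding r.toEmbedding
  have hid : ∀ r : Fin n ↪o Fin n, ⇑r = id := fun r =>
    (StrictMono.range_inj r.strictMono strictMono_id).1 (by
      rw [(Finite.injective_iff_surjective.1 r.injective).range_eq, Set.range_id])
  have hmem : n ∈ {k : ℕ | ∃ r c : Fin k ↪o Fin n, (A.submatrix r c).det ≠ 0} ↔ A.det ≠ 0 := by
    constructor
    · rintro ⟨r, c, h⟩
      rwa [hid r, hid c, Matrix.submatrix_id_id] at h
    · intro h
      exact ⟨RelEmbedding.refl _, RelEmbedding.refl _, by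
        rwa [hid, Matrix.submatrix_id_id]⟩
  rw [← hmem]
  constructor
  · intro h
    have hne : {k : ℕ | ∃ r c : Fin k ↪o Fin n, (A.submatrix r c).det ≠ 0}.Nonempty := by
      by_contra hemp
      rw [Set.not_nonempty_iff_eq_empty] at hemp
      rw [mRank, hemp, csSup_empty, Nat.bot_eq_zero] at h
      omega
    have := Nat.sSup_mem hne ⟨n, hb⟩
    rwa [show sSup {k : ℕ | ∃ r c : Fin k ↪o Fin n, (A.submatrix r c).det ≠ 0} = n from h] at this
  · exact fun h => (IsGreatest.csSup_eq ⟨h, hb⟩ : _)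

theorem probQ_eq_divProb {p n M : ℕ} [NeZero p] (hn : 1 ≤ n) :
    probQ n (p ^ M) = divProb (p : ZMod (p ^ M)) (Fin n) M := by
  classical
  have hne : Nonempty (SymMat (Fin n) (ZMod (p ^ M))) := ⟨⟨0, Matrix.isSymm_zero⟩⟩
  have hall : ({A : Matrix (Fin n) (Fin n) (ZMod (p ^ M)) | A.IsSymm}.ncard) =
      Fintype.card (SymMat (Fin n) (ZMod (p ^ M))) := by
    rw [← Nat.card_eq_fintype_card]
    rfl
  have hrank : ({A : Matrix (Fin n) (Fin n) (ZMod (p ^ M)) | A.IsSymm ∧ mRank A = n}.ncard) =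
      #{A : SymMat (Fin n) (ZMod (p ^ M)) | A.1.det ≠ 0} := by
    have hinj : Function.Injective fun A : SymMat (Fin n) (ZMod (p ^ M)) => A.1 :=
      Subtype.val_injective
    rw [← Set.ncard_coe_finset]
    refine Eq.trans ?_ (Set.ncard_image_of_injective _ hinj)
    congr 1
    ext A
    simp only [Set.mem_ofPred_eq, mRank_eq_iff hn, Set.mem_image, Finset.coe_filter,
      Finset.mem_univ, true_and]
    exact ⟨fun h => ⟨⟨A, h.1⟩, h.2, rfl⟩, fun ⟨B, hB, hBA⟩ => hBA ▸ ⟨B.2, hB⟩⟩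
  have hpow : (p : ZMod (p ^ M)) ^ M = 0 := by
    rw [← Nat.cast_pow, ZMod.natCast_self]
  have hN : (Fintype.card (SymMat (Fin n) (ZMod (p ^ M))) : ℝ) ≠ 0 := by
    exact_mod_cast Fintype.card_ne_zero
  have hsum : ∑ A : SymMat (Fin n) (ZMod (p ^ M)), dvdInd (p : ZMod (p ^ M)) M A.1.det =
      #{A : SymMat (Fin n) (ZMod (p ^ M)) | A.1.det = 0} := by
    simp only [dvdInd, hpow, zero_dvd_iff]
    rw [Finset.sum_boole]
  have hsplit := Finset.card_filter_add_card_filter_not (s := univ)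
    (p := fun A : SymMat (Fin n) (ZMod (p ^ M)) => A.1.det = 0)
  rw [Finset.card_univ] at hsplit
  rw [probQ, probP, hall, hrank, divProb, Fintype.expect_eq_sum_div_card, hsum,
    eq_div_iff hN, sub_mul, one_mul, div_mul_cancel₀ _ hN, ← hsplit]
  push_cast
  ring

theorem theorem5p2 (p n μ k s : ℕ) (q : ℝ) (hp : p.Prime) (hq : q = 1 / (p : ℝ))
    (hn : 1 ≤ n) (hμ : 1 ≤ μ) (hk : k = n / 2) (hs : s = (μ - 1) / 2) :
    probQ n (p ^ μ) = 1 - probP n (p ^ μ) ∧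
    probQ n (p ^ μ) = (q ^ μ * (1 - q ^ n) - remainderR q n μ k s) / (1 - q) ∧
    0 ≤ remainderR q n μ k s ∧
    remainderR q n μ k s < q ^ ((3 * (μ : ℝ)) / 2) := by
  have : NeZero p := ⟨hp.ne_zero⟩
  have hp2 : (2 : ℝ) ≤ p := by exact_mod_cast hp.two_le
  have h0 : 0 < q := by rw [hq]; positivity
  have h1 : q ≤ 1 / 2 := by
    rw [hq]
    exact one_div_le_one_div_of_le (by norm_num) hp2
  refine ⟨rfl, ?_, remainderR_nonneg h0 h1 hμ hk hs, remainderR_lt h0 h1 hμ hk hs⟩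
  have hrec := zmod_detRecursion (M := μ) hp hμ
  rw [← hq] at hrec
  have hcl := hrec.closed h0 (by linarith) hn μ le_rfl
  rw [← hk, show (μ + 1) / 2 = s + 1 by omega,
    detForm_eq_sub_remainder h0 (by linarith) n μ k s] at hcl
  rw [probQ_eq_divProb hn, eq_div_iff (by linarith), mul_comm]
  exact hcl
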